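/- Let $X$ be a complex Banach space and let $T$ be a closed linear operator with domain $D(T)\subseteq X$ (not necessarily dense) and values in $X$, whose resolvent set $\rho(T)$ is non-empty. Then $T$ belongs to the class $\mathfrak M(0,\infty)$ if and only if $$\sigma_{BF}(T)=\{\lambda\in\mathbb C : T-\lambda I \text{ is not a B-Fredholm operator}\}\subseteq\{0\}.$$ Here $\rho(T)$ is the set of $\lambda\in\mathbb C$ such that $T-\lambda I:D(T)\to X$ has an everywhere defined bounded inverse, and $\sigma(T)=\mathbb C\setminus\rho(T)$. The operator $T$ belongs to $\mathfrak M(0,\infty)$ if $\sigma(T)$ has no accumulation points in $\mathbb C\cup\{\infty\}$ other than (possibly) $0$ and $\infty$, and every nonzero isolated point of $\sigma(T)$ is a pole of the resolvent $\mu\mapsto (T-\mu I)^{-1}$. A closed operator is Fredholm if its null space has finite dimension and its range has finite codimension. A closed operator $S$ in $X$ is B-Fredholm if, for some integer $n\ge 0$, the range $R(S^n)$ is closed in $X$ and the restriction $S_n: D(S)\cap R(S^n)\to R(S^n)$ of $S$, viewed as an operator in the Banach space $R(S^n)$, is Fredholm (with $S^0=I$, and $S^n$ taken on its natural domain). -/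

import Mathlib

open Filter Topology
open scoped OnePoint

namespace UnboundedOp

section Algebra

variable {X : Type*} [AddCommGroup X] [Module ℂ X]

/-- The operator `T - lam I`, with the same domain as `T`. -/
def shift (T : X →ₗ.[ℂ] X) (lam : ℂ) : X →ₗ.[ℂ] X where
  domain := T.domain
  toFun := T.toFun - lam • T.domain.subtype

/-- The composition `S T` on its natural domain `{x ∈ D(T) | T x ∈ D(S)}`. -/
def mul (S T : X →ₗ.[ℂ] X) : X →ₗ.[ℂ] X where
  domain :=
    { carrier := {x | ∃ h : x ∈ T.domain, T ⟨x, h⟩ ∈ S.domain}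
      zero_mem' := ⟨T.domain.zero_mem, by
        have h0 : T ⟨0, T.domain.zero_mem⟩ = 0 := T.map_zero
        rw [h0]; exact S.domain.zero_mem⟩
      add_mem' := by
        rintro x y ⟨hx, hx'⟩ ⟨hy, hy'⟩
        refine ⟨T.domain.add_mem hx hy, ?_⟩
        have h : T ⟨x + y, T.domain.add_mem hx hy⟩ = T ⟨x, hx⟩ + T ⟨y, hy⟩ :=
          T.map_add ⟨x, hx⟩ ⟨y, hy⟩
        rw [h]; exact S.domain.add_mem hx' hy'
      smul_mem' := by
        rintro c x ⟨hx, hx'⟩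
        refine ⟨T.domain.smul_mem c hx, ?_⟩
        have h : T ⟨c • x, T.domain.smul_mem c hx⟩ = c • T ⟨x, hx⟩ :=
          T.map_smul c ⟨x, hx⟩
        rw [h]; exact S.domain.smul_mem c hx' }
  toFun :=
    { toFun := fun x => S ⟨T ⟨x.1, x.2.1⟩, x.2.2⟩
      map_add' := by
        intro x y
        rw [← S.map_add]
        congr 1
        exact Subtype.ext (T.map_add ⟨x.1, x.2.1⟩ ⟨y.1, y.2.1⟩)
      map_smul' := by
        intro c x
        rw [RingHom.id_apply, ← S.map_smul]
        congr 1
        exact Subtype.ext (T.map_smul c ⟨x.1, x.2.1⟩) }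

/-- The powers of `T` on their natural domains: `T ^ 0 = I` (everywhere defined) and
`T ^ (n + 1) = T T ^ n`. -/
def pow (T : X →ₗ.[ℂ] X) : ℕ → (X →ₗ.[ℂ] X)
  | 0 => (LinearMap.id : X →ₗ[ℂ] X).toPMap ⊤
  | n + 1 => mul T (pow T n)

/-- The range `R(T)`, a subspace of `X`. -/
def range (T : X →ₗ.[ℂ] X) : Submodule ℂ X := LinearMap.range T.toFun

/-- The null space `N(T)`, as a subspace of the domain of `T`. -/
def null (T : X →ₗ.[ℂ] X) : Submodule ℂ T.domain := LinearMap.ker T.toFun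

/-- The restriction of `T` to a subspace `M`, viewed as an operator in `M`. Its domain consists
of all `x ∈ M ∩ D(T)` with `T x ∈ M`; if `T` maps `M ∩ D(T)` into `M` this is all of
`M ∩ D(T)`. -/
def part (T : X →ₗ.[ℂ] X) (M : Submodule ℂ X) : M →ₗ.[ℂ] M where
  domain :=
    { carrier := {x | ∃ h : (x : X) ∈ T.domain, T ⟨x, h⟩ ∈ M}
      zero_mem' := ⟨T.domain.zero_mem, by
        have h0 : T ⟨0, T.domain.zero_mem⟩ = 0 := T.map_zero
        exact h0 ▸ M.zero_mem⟩
      add_mem' := by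
        rintro x y ⟨hx, hx'⟩ ⟨hy, hy'⟩
        refine ⟨T.domain.add_mem hx hy, ?_⟩
        have h : T ⟨x + y, T.domain.add_mem hx hy⟩ = T ⟨x, hx⟩ + T ⟨y, hy⟩ :=
          T.map_add ⟨x, hx⟩ ⟨y, hy⟩
        exact h ▸ M.add_mem hx' hy'
      smul_mem' := by
        rintro c x ⟨hx, hx'⟩
        refine ⟨T.domain.smul_mem c hx, ?_⟩
        have h : T ⟨c • x, T.domain.smul_mem c hx⟩ = c • T ⟨x, hx⟩ :=
          T.map_smul c ⟨x, hx⟩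
        exact h ▸ M.smul_mem c hx' }
  toFun :=
    { toFun := fun x => ⟨T ⟨x.1, x.2.1⟩, x.2.2⟩
      map_add' := fun x y => Subtype.ext (T.map_add ⟨x.1, x.2.1⟩ ⟨y.1, y.2.1⟩)
      map_smul' := fun c x => Subtype.ext (T.map_smul c ⟨x.1, x.2.1⟩) }

/-- If `y ∈ D(T ^ n)` and `T ^ n y ∈ D(T)`, then `y ∈ D(T)`, `T y ∈ D(T ^ n)` and
`T (T ^ n y) = T ^ n (T y)`. -/
theorem pow_comm (T : X →ₗ.[ℂ] X) (n : ℕ) :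
    ∀ (y : X) (hy : y ∈ (pow T n).domain) (hy' : pow T n ⟨y, hy⟩ ∈ T.domain),
      ∃ (h : y ∈ T.domain) (h' : T ⟨y, h⟩ ∈ (pow T n).domain),
        pow T n ⟨T ⟨y, h⟩, h'⟩ = T ⟨pow T n ⟨y, hy⟩, hy'⟩ := by
  induction n with
  | zero => exact fun y _ hy' => ⟨hy', trivial, rfl⟩
  | succ n ih =>
    rintro y ⟨hy, hyT⟩ hy'
    obtain ⟨h, h', e⟩ := ih y hy hyT
    have e' : T ⟨pow T n ⟨y, hy⟩, hyT⟩ ∈ T.domain := hy'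
    refine ⟨h, ⟨h', e ▸ e'⟩, ?_⟩
    have : (⟨pow T n ⟨T ⟨y, h⟩, h'⟩, e ▸ e'⟩ : T.domain)
        = ⟨T ⟨pow T n ⟨y, hy⟩, hyT⟩, e'⟩ := Subtype.ext e
    exact congrArg T this

/-- `T` maps `R(T ^ n) ∩ D(T)` into `R(T ^ n)`. -/
theorem map_range_pow (T : X →ₗ.[ℂ] X) (n : ℕ) (x : X) (hx : x ∈ range (pow T n))
    (h : x ∈ T.domain) : T ⟨x, h⟩ ∈ range (pow T n) := by
  obtain ⟨⟨y, hy⟩, rfl⟩ := hx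
  obtain ⟨h₁, h₂, e⟩ := pow_comm T n y hy h
  exact ⟨⟨T ⟨y, h₁⟩, h₂⟩, e⟩

/-- Consequently the restriction of `T` to `R(T ^ n)` has the domain `R(T ^ n) ∩ D(T)`. -/
theorem mem_domain_part_range_pow (T : X →ₗ.[ℂ] X) (n : ℕ) (x : range (pow T n)) :
    x ∈ (part T (range (pow T n))).domain ↔ (x : X) ∈ T.domain :=
  ⟨fun h => h.1, fun h => ⟨h, map_range_pow T n x x.2 h⟩⟩

end Algebra

variable {X : Type*} [NormedAddCommGroup X] [NormedSpace ℂ X]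

/-- A closed operator is Fredholm if its null space has finite dimension and its range has
finite codimension. -/
def IsFredholm (T : X →ₗ.[ℂ] X) : Prop :=
  T.IsClosed ∧ FiniteDimensional ℂ (null T) ∧ FiniteDimensional ℂ (X ⧸ range T)

/-- `T` is B-Fredholm if for some `n` the range of `T ^ n` is closed and the restriction
`T_n : D(T) ∩ R(T ^ n) → R(T ^ n)` of `T` is a Fredholm operator. -/
def IsBFredholm (T : X →ₗ.[ℂ] X) : Prop :=
  ∃ n : ℕ, IsClosed (range (pow T n) : Set X) ∧ IsFredholm (part T (range (pow T n)))

/-- The B-Fredholm spectrum. -/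
def bFredholmSpectrum (T : X →ₗ.[ℂ] X) : Set ℂ :=
  {lam | ¬ IsBFredholm (shift T lam)}

/-- The bounded operator `S` is a two-sided inverse of `T : D(T) → X`. -/
def IsBoundedInverse (T : X →ₗ.[ℂ] X) (S : X →L[ℂ] X) : Prop :=
  (∀ x : X, ∃ h : S x ∈ T.domain, T ⟨S x, h⟩ = x) ∧ ∀ y : T.domain, S (T y) = y

/-- The resolvent set: all `lam` such that `T - lam I` has an everywhere defined bounded
inverse. -/
def resolventSet (T : X →ₗ.[ℂ] X) : Set ℂ :=
  {lam | ∃ S : X →L[ℂ] X, IsBoundedInverse (shift T lam) S}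

/-- The spectrum. -/
def spectrum (T : X →ₗ.[ℂ] X) : Set ℂ := (resolventSet T)ᶜ

open Classical in
/-- The resolvent `R(mu) = (T - mu I)⁻¹` on the resolvent set; it is given the value `0`
elsewhere. -/
noncomputable def resolvent (T : X →ₗ.[ℂ] X) (mu : ℂ) : X →L[ℂ] X :=
  if h : ∃ S : X →L[ℂ] X, IsBoundedInverse (shift T mu) S then h.choose else 0

/-- `lam` is an isolated point of the spectrum. -/
def IsIsolatedInSpectrum (T : X →ₗ.[ℂ] X) (lam : ℂ) : Prop :=
  lam ∈ spectrum T ∧ ¬ AccPt lam (𝓟 (spectrum T))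

/-- `lam` is a pole of the resolvent of `T`: the resolvent is defined on a punctured
neighbourhood of `lam` and has a pole (of some order `p ≥ 1`) at `lam`. -/
def IsResolventPole (T : X →ₗ.[ℂ] X) (lam : ℂ) : Prop :=
  (∀ᶠ mu in 𝓝[≠] lam, mu ∈ resolventSet T) ∧
    MeromorphicAt (resolvent T) lam ∧ meromorphicOrderAt (resolvent T) lam < 0

/-- The class `M(0, ∞)`: in the Riemann sphere the spectrum has no accumulation points other
than `0` and `∞`, and every nonzero isolated point of the spectrum is a pole of the
resolvent. -/
def IsMeromorphicZeroInfty (T : X →ₗ.[ℂ] X) : Prop :=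
  (∀ z : OnePoint ℂ, AccPt z (𝓟 ((fun w : ℂ => (w : OnePoint ℂ)) '' spectrum T)) →
      z = ((0 : ℂ) : OnePoint ℂ) ∨ z = ∞) ∧
    ∀ lam : ℂ, lam ≠ 0 → IsIsolatedInSpectrum T lam → IsResolventPole T lam

end UnboundedOp

/-! Fix `mu` in the resolvent set, put `R = (T - mu I)⁻¹`, and let `a = I - (lam - mu) R = (T - lam
I) R`. The bounded operator `a` commutes with `R`, and `T - lam I` and `a` have the same null space
and the same ranges of powers, so one is B-Fredholm exactly when the other is
(`isBFredholm_shift_iff`). The resolvent of `T` and the inverse of `z ↦ a - (z - lam) R` determine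
each other.

If the resolvent has a pole at `lam`, comparing coefficients in the expansion of the inverse yields
`a ^ q = a ^ (q + 1) c` with `c` commuting with `a` (`exists_pow_eq_pow_succ_mul_of_analyticAt`).
Then `a` is bijective on the closed space `R(a ^ q)`, hence B-Fredholm.

Conversely, let `a` be B-Fredholm and `lam` a limit of resolvent points. Then `a` is a limit of
invertible operators commuting with it, which forces `a` to be invertible on some closed `R(a ^ p)`
(`exists_isUnit_restrict_range_pow`); so `lam` is a resolvent point or a pole
(`meromorphicAt_resolvent_of_isBFredholm`). Connectedness of `ℂ ∖ {0}` spreads this from one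
resolvent point to all nonzero points. -/

namespace UnboundedOp

/-! ### Closed ranges, and limits of invertible operators -/

section Bounded

variable {Z : Type*} [NormedAddCommGroup Z] [NormedSpace ℂ Z] [CompleteSpace Z]

/-- A bounded operator between Banach spaces whose range has finite codimension has closed
range. -/
theorem isClosed_range_of_finiteDimensional_quotient (a : Z →L[ℂ] Z)
    [FiniteDimensional ℂ (Z ⧸ a.range)] : IsClosed (a.range : Set Z) := by
  have hk : IsClosed (a.ker : Set Z) := a.isClosed_ker
  obtain ⟨G, hG⟩ := Submodule.exists_isCompl a.range
  have : FiniteDimensional ℂ G :=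
    (Submodule.quotientEquivOfIsCompl _ _ hG).finiteDimensional
  -- Passing to the quotient makes the operator injective with the same range, whose algebraic
  -- complement `G` is closed because it is finite dimensional.
  let v : (Z ⧸ a.ker) →L[ℂ] Z := a.ker.liftQL a le_rfl
  have hv : (v : (Z ⧸ a.ker) →ₗ[ℂ] Z) = a.ker.liftQ (a : Z →ₗ[ℂ] Z) le_rfl := rfl
  have hr : v.range = a.range := by
    rw [hv, Submodule.range_liftQ]
  have hker : v.ker = ⊥ := by
    rw [hv, Submodule.ker_liftQ_eq_bot _ _ _ le_rfl]
  have := v.closed_complemented_range_of_isCompl_of_ker_eq_bot G (hr ▸ hG)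
    G.closed_of_finiteDimensional hker
  rwa [hr] at this

/-- If `b` is invertible, `a` is close to `b` and `b⁻¹` is bounded by `K` with `‖a - b‖ K < 1`,
then `a` is invertible. -/
theorem isUnit_of_norm_sub_mul_lt_one {a : Z →L[ℂ] Z} (b : (Z →L[ℂ] Z)ˣ)
    (h : ‖((b⁻¹ : (Z →L[ℂ] Z)ˣ) : Z →L[ℂ] Z)‖ * ‖a - b‖ < 1) : IsUnit a := by
  have h1 : ‖((b⁻¹ : (Z →L[ℂ] Z)ˣ) : Z →L[ℂ] Z) * (b - a)‖ < 1 := by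
    refine (norm_mul_le _ _).trans_lt ?_
    rwa [norm_sub_rev (b : Z →L[ℂ] Z) a]
  have h2 := b.isUnit.mul (isUnit_one_sub_of_norm_lt_one h1)
  have h3 : (b : Z →L[ℂ] Z) * (1 - ((b⁻¹ : (Z →L[ℂ] Z)ˣ) : Z →L[ℂ] Z) * (b - a)) = a := by
    rw [mul_sub, mul_one, ← mul_assoc, Units.mul_inv, one_mul, sub_sub_cancel]
  rwa [h3] at h2

/-- A surjective bounded operator that is a limit of invertible operators is invertible. -/
theorem isUnit_of_surjective_of_approx {a : Z →L[ℂ] Z} (ha : Function.Surjective a)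
    (happ : ∀ ε > 0, ∃ b : (Z →L[ℂ] Z)ˣ, ‖a - b‖ < ε) : IsUnit a := by
  obtain ⟨C, hC, hpre⟩ := a.exists_preimage_norm_le ha
  -- `C` is the open mapping constant of `a`. An error below `1 / (4 C)` gives `‖b⁻¹‖ ≤ C + ‖b⁻¹‖ /
  -- 4`, hence `‖b⁻¹‖ ≤ 2 C` and `‖b⁻¹‖ ‖a - b‖ ≤ 1 / 2`.
  obtain ⟨b, hb⟩ := happ (1 / (4 * C)) (by positivity)
  refine isUnit_of_norm_sub_mul_lt_one b ?_
  set w : Z →L[ℂ] Z := ((b⁻¹ : (Z →L[ℂ] Z)ˣ) : Z →L[ℂ] Z) with hw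
  have hwb : ∀ x, w ((b : Z →L[ℂ] Z) x) = x := fun x => by
    rw [← mul_apply_eq_comp, hw, Units.inv_mul, one_apply_eq_self]
  have hε : ‖a - b‖ * C ≤ 1 / 4 := by
    have := mul_le_mul_of_nonneg_right hb.le hC.le
    have h4 : 1 / (4 * C) * C = 1 / 4 := by field_simp
    linarith
  have hbound : ‖w‖ ≤ C + ‖w‖ * (‖a - b‖ * C) := by
    refine w.opNorm_le_bound (by positivity) fun y => ?_
    obtain ⟨x, rfl, hx⟩ := hpre y
    have e : w (a x) = x + w ((a - b) x) := by
      rw [sub_apply, map_sub, hwb, add_sub_cancel]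
    have h1 : ‖w ((a - b) x)‖ ≤ ‖w‖ * (‖a - b‖ * (C * ‖a x‖)) :=
      (w.le_opNorm _).trans <| mul_le_mul_of_nonneg_left
        (((a - b).le_opNorm x).trans (mul_le_mul_of_nonneg_left hx (norm_nonneg _)))
        (norm_nonneg _)
    calc ‖w (a x)‖ ≤ ‖x‖ + ‖w ((a - b) x)‖ := e ▸ norm_add_le _ _
      _ ≤ C * ‖a x‖ + ‖w‖ * (‖a - b‖ * (C * ‖a x‖)) := add_le_add hx h1
      _ = _ := by ring
  have h2 : ‖w‖ * (‖a - b‖ * C) ≤ ‖w‖ * (1 / 4) := mul_le_mul_of_nonneg_left hε (norm_nonneg _)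
  have h3 : ‖w‖ ≤ 2 * C := by linarith
  have h4 : ‖w‖ * ‖a - b‖ ≤ 2 * C * ‖a - b‖ := mul_le_mul_of_nonneg_right h3 (norm_nonneg _)
  linarith

/-- An injective bounded operator with closed range that is a limit of invertible operators is
invertible. -/
theorem isUnit_of_injective_of_approx {a : Z →L[ℂ] Z} (ha : Function.Injective a)
    (hcl : IsClosed (Set.range a))
    (happ : ∀ ε > 0, ∃ b : (Z →L[ℂ] Z)ˣ, ‖a - b‖ < ε) : IsUnit a := by
  obtain ⟨K, hK⟩ := a.antilipschitz_of_injective_of_isClosed_range ha hcl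
  have hbd : ∀ x, ‖x‖ ≤ (K + 1) * ‖a x‖ := fun x => by
    have := hK.le_mul_dist x 0
    rw [map_zero, dist_zero_right, dist_zero_right] at this
    nlinarith [norm_nonneg (a x)]
  -- `K` may be zero; adding 1 keeps the lower bound for `a` and allows division by `C`. The bound
  -- `‖b⁻¹‖ ≤ 2 C` now comes from applying the lower bound to `b⁻¹ y`.
  set C : ℝ := K + 1 with hCdef
  have hC : 0 < C := by positivity
  obtain ⟨b, hb⟩ := happ (1 / (4 * C)) (by positivity)
  refine isUnit_of_norm_sub_mul_lt_one b ?_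
  set w : Z →L[ℂ] Z := ((b⁻¹ : (Z →L[ℂ] Z)ˣ) : Z →L[ℂ] Z) with hw
  have hbw : ∀ x, (b : Z →L[ℂ] Z) (w x) = x := fun x => by
    rw [← mul_apply_eq_comp, hw, Units.mul_inv, one_apply_eq_self]
  have hε : C * ‖a - b‖ ≤ 1 / 4 := by
    have := mul_le_mul_of_nonneg_left hb.le hC.le
    have h4 : C * (1 / (4 * C)) = 1 / 4 := by field_simp
    linarith
  have h3 : ‖w‖ ≤ 2 * C := by
    refine w.opNorm_le_bound (by positivity) fun y => ?_
    have e : a (w y) = y + (a - b) (w y) := by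
      rw [sub_apply, hbw, add_sub_cancel]
    have h1 : ‖a (w y)‖ ≤ ‖y‖ + ‖a - b‖ * ‖w y‖ :=
      e ▸ (norm_add_le _ _).trans (add_le_add le_rfl ((a - b).le_opNorm _))
    have h2 := mul_le_mul_of_nonneg_left h1 hC.le
    have h5 := mul_le_mul_of_nonneg_right hε (norm_nonneg (w y))
    have h6 := hbd (w y)
    have h7 : 0 ≤ C * ‖y‖ := by positivity
    linarith
  have h4 : ‖w‖ * ‖a - b‖ ≤ 2 * C * ‖a - b‖ := mul_le_mul_of_nonneg_right h3 (norm_nonneg _)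
  linarith

omit [CompleteSpace Z] in
/-- Restrictions to an invariant subspace of a limit of invertible operators which, together with
their inverses, leave the subspace invariant. -/
theorem approx_restrict {a : Z →L[ℂ] Z} {Y : Submodule ℂ Z} (ha : ∀ x ∈ Y, a x ∈ Y)
    (happ : ∀ ε > 0, ∃ b : (Z →L[ℂ] Z)ˣ, (∀ x ∈ Y, (b : Z →L[ℂ] Z) x ∈ Y) ∧
      (∀ x ∈ Y, ((b⁻¹ : (Z →L[ℂ] Z)ˣ) : Z →L[ℂ] Z) x ∈ Y) ∧ ‖a - b‖ < ε) :
    ∀ ε > 0, ∃ b : (Y →L[ℂ] Y)ˣ, ‖a.restrict ha - b‖ < ε := by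
  intro ε hε
  obtain ⟨b, hb, hb', hab⟩ := happ ε hε
  refine ⟨⟨(b : Z →L[ℂ] Z).restrict hb, ((b⁻¹ : (Z →L[ℂ] Z)ˣ) : Z →L[ℂ] Z).restrict hb', ?_, ?_⟩,
    lt_of_le_of_lt ?_ hab⟩
  · ext x
    change (((b : Z →L[ℂ] Z) * ((b⁻¹ : (Z →L[ℂ] Z)ˣ) : Z →L[ℂ] Z)) x : Z) = x
    rw [Units.mul_inv]; rfl
  · ext x
    change ((((b⁻¹ : (Z →L[ℂ] Z)ˣ) : Z →L[ℂ] Z) * (b : Z →L[ℂ] Z)) x : Z) = x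
    rw [Units.inv_mul]; rfl
  · exact ContinuousLinearMap.opNorm_le_bound _ (norm_nonneg _) fun x => (a - b).le_opNorm (x : Z)

end Bounded

/-! ### Ranges of powers of a bounded B-Fredholm operator -/

section Bounded

variable {Z : Type*} [NormedAddCommGroup Z] [NormedSpace ℂ Z]

theorem map_mem_range_pow_succ (a : Z →L[ℂ] Z) {m : ℕ} {x : Z} (hx : x ∈ (a ^ m).range) :
    a x ∈ (a ^ (m + 1)).range := by
  obtain ⟨y, rfl⟩ := hx
  exact ⟨y, by rw [pow_succ']; rfl⟩

theorem exists_mem_range_pow_of_mem_range_pow_succ (a : Z →L[ℂ] Z) {m : ℕ} {x : Z}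
    (hx : x ∈ (a ^ (m + 1)).range) : ∃ y ∈ (a ^ m).range, a y = x := by
  obtain ⟨y, rfl⟩ := hx
  exact ⟨(a ^ m) y, ⟨y, rfl⟩, by rw [pow_succ']; rfl⟩

theorem range_pow_antitone (a : Z →L[ℂ] Z) : Antitone fun m => (a ^ m).range := by
  refine antitone_nat_of_succ_le fun m => ?_
  rintro _ ⟨y, rfl⟩
  exact ⟨a y, by rw [pow_succ]; rfl⟩

theorem map_mem_range_pow (a : Z →L[ℂ] Z) {m : ℕ} {x : Z} (hx : x ∈ (a ^ m).range) :
    a x ∈ (a ^ m).range :=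
  range_pow_antitone a m.le_succ (map_mem_range_pow_succ a hx)

theorem map_mem_range_pow_of_commute {a b : Z →L[ℂ] Z} (h : Commute a b) {m : ℕ} {x : Z}
    (hx : x ∈ (a ^ m).range) : b x ∈ (a ^ m).range := by
  obtain ⟨y, rfl⟩ := hx
  exact ⟨b y, congrArg (fun u : Z →L[ℂ] Z => u y) (h.pow_left m).eq⟩

/-- If `a` induces a Fredholm operator on the closed subspace `R(a ^ n)`, then all further ranges
`R(a ^ m)` are closed. -/
theorem isClosed_range_pow_of_le [CompleteSpace Z] (a : Z →L[ℂ] Z) {n : ℕ}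
    (hcl : IsClosed ((a ^ n).range : Set Z))
    (hq : FiniteDimensional ℂ ((a ^ n).range ⧸ (a ^ (n + 1)).range.comap (a ^ n).range.subtype))
    {m : ℕ} (hm : n ≤ m) : IsClosed ((a ^ m).range : Set Z) := by
  -- The finite codimension must be carried through the induction: it makes the next range closed,
  -- and it persists because `a` maps `R(a ^ m) / R(a ^ (m + 1))` onto the next quotient.
  suffices h : IsClosed ((a ^ m).range : Set Z) ∧ FiniteDimensional ℂ
      ((a ^ m).range ⧸ (a ^ (m + 1)).range.comap (a ^ m).range.subtype) from h.1
  induction m, hm using Nat.le_induction with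
  | base => exact ⟨hcl, hq⟩
  | succ m hm ih =>
    obtain ⟨hc, hf⟩ := ih
    have : CompleteSpace (a ^ m).range := hc.completeSpace_coe
    constructor
    · let c : (a ^ m).range →L[ℂ] (a ^ m).range := a.restrict fun x hx => map_mem_range_pow a hx
      have hr : c.range = (a ^ (m + 1)).range.comap (a ^ m).range.subtype := by
        ext x
        constructor
        · rintro ⟨y, rfl⟩
          exact map_mem_range_pow_succ a y.2
        · intro hx
          obtain ⟨y, hy, e⟩ := exists_mem_range_pow_of_mem_range_pow_succ a hx
          exact ⟨⟨y, hy⟩, Subtype.ext e⟩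
      rw [← hr] at hf
      have h1 := isClosed_range_of_finiteDimensional_quotient c
      have h2 := hc.isClosedEmbedding_subtypeVal.isClosedMap _ h1
      convert h2 using 1
      rw [hr]
      ext x
      constructor
      · intro hx
        exact ⟨⟨x, range_pow_antitone a m.le_succ hx⟩, hx, rfl⟩
      · rintro ⟨y, hy, rfl⟩
        exact hy
    · let f : (a ^ m).range →ₗ[ℂ] (a ^ (m + 1)).range :=
        (a : Z →ₗ[ℂ] Z).restrict fun x hx => map_mem_range_pow_succ a hx
      let g := ((a ^ (m + 1 + 1)).range.comap (a ^ (m + 1)).range.subtype).mkQ.comp f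
      have hg : (a ^ (m + 1)).range.comap (a ^ m).range.subtype ≤ LinearMap.ker g := by
        intro x hx
        rw [LinearMap.mem_ker]
        exact (Submodule.Quotient.mk_eq_zero _).2 (map_mem_range_pow_succ a hx)
      refine Module.Finite.of_surjective (Submodule.liftQ _ g hg) fun z => ?_
      obtain ⟨z, rfl⟩ := Submodule.Quotient.mk_surjective _ z
      obtain ⟨y, hy, e⟩ := exists_mem_range_pow_of_mem_range_pow_succ a z.2
      refine ⟨Submodule.Quotient.mk ⟨y, hy⟩, ?_⟩
      rw [Submodule.liftQ_apply]
      exact congrArg Submodule.Quotient.mk (Subtype.ext e)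

/-- The subspaces `N(a) ∩ R(a ^ m)` become stationary if one of them is finite dimensional. -/
theorem exists_ker_inf_range_pow_le (a : Z →L[ℂ] Z) {n : ℕ}
    (hk : FiniteDimensional ℂ ↥(a.ker ⊓ (a ^ n).range)) :
    ∃ p, n ≤ p ∧ ∀ m, p ≤ m → a.ker ⊓ (a ^ p).range ≤ (a ^ m).range := by
  let d : ℕ → ℕ := fun j => Module.finrank ℂ ↥(a.ker ⊓ (a ^ (n + j)).range)
  have hle : ∀ {i j : ℕ}, i ≤ j → a.ker ⊓ (a ^ j).range ≤ a.ker ⊓ (a ^ i).range := fun h =>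
    inf_le_inf_left _ (range_pow_antitone a h)
  obtain ⟨j, hj⟩ : ∃ j, ∀ k, d j ≤ d k := by
    obtain ⟨j, hj⟩ := WellFounded.has_min (measure d).wf Set.univ Set.univ_nonempty
    exact ⟨j, fun k => not_lt.1 (hj.2 k trivial)⟩
  refine ⟨n + j, Nat.le_add_right _ _, fun m hm => ?_⟩
  obtain ⟨k, rfl⟩ := Nat.exists_eq_add_of_le hm
  have : FiniteDimensional ℂ ↥(a.ker ⊓ (a ^ (n + j)).range) :=
    Submodule.finiteDimensional_of_le (hle (Nat.le_add_right n j))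
  have he := Submodule.eq_of_le_of_finrank_le (hle hm) (by
    rw [add_assoc]
    exact hj (j + k))
  exact he ▸ inf_le_right

/-- A B-Fredholm operator that is a limit of invertible operators commuting with it is
bijective on the closed range of one of its powers. -/
theorem exists_isUnit_restrict_range_pow [CompleteSpace Z] (a : Z →L[ℂ] Z) {n : ℕ}
    (hcl : IsClosed ((a ^ n).range : Set Z))
    (hk : FiniteDimensional ℂ ↥(a.ker ⊓ (a ^ n).range))
    (hq : FiniteDimensional ℂ ((a ^ n).range ⧸ (a ^ (n + 1)).range.comap (a ^ n).range.subtype))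
    (happ : ∀ ε > 0, ∃ b : (Z →L[ℂ] Z)ˣ, Commute a (b : Z →L[ℂ] Z) ∧ ‖a - b‖ < ε) :
    ∃ p, IsClosed ((a ^ p).range : Set Z) ∧
      IsUnit (a.restrict (p := (a ^ p).range) (q := (a ^ p).range)
        fun _ hx => map_mem_range_pow a hx) := by
  have hclosed : ∀ m, n ≤ m → IsClosed ((a ^ m).range : Set Z) := fun m hm =>
    isClosed_range_pow_of_le a hcl hq hm
  obtain ⟨p, hnp, hp⟩ := exists_ker_inf_range_pow_le a hk
  have hcomm : ∀ {b : (Z →L[ℂ] Z)ˣ}, Commute a (b : Z →L[ℂ] Z) →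
      Commute a ((b⁻¹ : (Z →L[ℂ] Z)ˣ) : Z →L[ℂ] Z) := fun h => h.units_inv_right
  -- By the choice of `p`, `N` contains `N(a) ∩ R(a ^ p)`. Once `a` is invertible on `N`, this
  -- intersection is therefore zero.
  let N : Submodule ℂ Z := ⨅ j : ℕ, (a ^ (p + j)).range
  have hN : ∀ {x}, x ∈ N ↔ ∀ j, x ∈ (a ^ (p + j)).range := Submodule.mem_iInf _
  have hNcl : IsClosed (N : Set Z) := by
    rw [Submodule.coe_iInf]
    exact isClosed_iInter fun j => hclosed _ (by omega)
  have : CompleteSpace N := hNcl.completeSpace_coe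
  have haN : ∀ x ∈ N, a x ∈ N := fun x hx => hN.2 fun j => map_mem_range_pow a (hN.1 hx j)
  have hsurj : Function.Surjective (a.restrict haN) := by
    rintro ⟨y, hy⟩
    obtain ⟨x, hx, hxy⟩ := exists_mem_range_pow_of_mem_range_pow_succ a (hN.1 hy 1)
    refine ⟨⟨x, hN.2 fun j => ?_⟩, Subtype.ext hxy⟩
    obtain ⟨z, hz, hzy⟩ := exists_mem_range_pow_of_mem_range_pow_succ a (hN.1 hy (j + 1))
    -- Two preimages of `y` in `R(a ^ p)` differ by a null vector lying in all later ranges, so the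
    -- one preimage `x` serves for every `j`.
    have hd : x - z ∈ (a ^ (p + j)).range := hp _ (Nat.le_add_right _ _)
      ⟨show a (x - z) = 0 by rw [map_sub, hxy, hzy, sub_self],
        Submodule.sub_mem _ hx (range_pow_antitone a (Nat.le_add_right p j) hz)⟩
    simpa using Submodule.add_mem _ hd hz
  have hunit := isUnit_of_surjective_of_approx hsurj <| approx_restrict haN fun ε hε => by
    obtain ⟨b, hab, hb⟩ := happ ε hε
    exact ⟨b, fun x hx => hN.2 fun j => map_mem_range_pow_of_commute hab (hN.1 hx j),
      fun x hx => hN.2 fun j => map_mem_range_pow_of_commute (hcomm hab) (hN.1 hx j), hb⟩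
  have hinjN := (ContinuousLinearMap.isUnit_iff_bijective.1 hunit).1
  refine ⟨p, hclosed p hnp, ?_⟩
  have : CompleteSpace (a ^ p).range := (hclosed p hnp).completeSpace_coe
  refine isUnit_of_injective_of_approx ?_ ?_ <| approx_restrict _ fun ε hε => by
    obtain ⟨b, hab, hb⟩ := happ ε hε
    exact ⟨b, fun x hx => map_mem_range_pow_of_commute hab hx,
      fun x hx => map_mem_range_pow_of_commute (hcomm hab) hx, hb⟩
  · refine (injective_iff_map_eq_zero _).2 fun x hx => ?_
    have hx0 : a (x : Z) = 0 := congrArg Subtype.val hx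
    have hxN : (x : Z) ∈ N := hN.2 fun j => hp _ (Nat.le_add_right _ _) ⟨hx0, x.2⟩
    have := (injective_iff_map_eq_zero _).1 hinjN ⟨x, hxN⟩ (Subtype.ext hx0)
    exact Subtype.ext (congrArg (fun u : N => (u : Z)) this)
  -- The range of the restriction is `R(a ^ (p + 1))`.
  · have h1 := (hclosed (p + 1) (by omega)).preimage
      (continuous_subtype_val (p := fun x => x ∈ (a ^ p).range))
    refine (congrArg IsClosed (Set.ext fun x => ⟨?_, fun hx => ?_⟩)).mpr h1
    · rintro ⟨y, rfl⟩
      exact map_mem_range_pow_succ a y.2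
    · obtain ⟨y, hy, e⟩ := exists_mem_range_pow_of_mem_range_pow_succ a hx
      exact ⟨⟨y, hy⟩, Subtype.ext e⟩

end Bounded

/-! ### From a pole to Drazin invertibility -/

/-- If the pencil `a - (z - lam) r` has an inverse with at most a pole at `lam`, then `a` is
Drazin invertible. -/
theorem exists_pow_eq_pow_succ_mul_of_analyticAt {𝔸 : Type*} [NormedRing 𝔸] [NormedAlgebra ℂ 𝔸]
    {a r : 𝔸} (har : Commute a r) {lam : ℂ} (p : ℕ) {F : ℂ → 𝔸} {d : 𝔸} {j : ℕ}
    (hF : AnalyticAt ℂ F lam) (hd : a ^ j * d = 0) (hcomm : ∀ᶠ z in 𝓝[≠] lam, Commute a (F z))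
    (hinv : ∀ᶠ z in 𝓝[≠] lam, (a - (z - lam) • r) * F z = d + (z - lam) ^ p • (1 : 𝔸)) :
    ∃ (q : ℕ) (c : 𝔸), Commute a c ∧ a ^ q = a ^ (q + 1) * c := by
  have hFc := hF.continuousAt
  have hcomm0 : Commute a (F lam) := by
    have h1 : ContinuousAt (fun z => a * F z) lam := by fun_prop
    have h2 : ContinuousAt (fun z => F z * a) lam := by fun_prop
    exact ((h1.eventuallyEq_nhds_iff_eventuallyEq_nhdsNE h2).1 hcomm).eq_of_nhds
  have hinv0 : (a - (lam - lam) • r) * F lam = d + (lam - lam) ^ p • (1 : 𝔸) := by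
    have h1 : ContinuousAt (fun z => (a - (z - lam) • r) * F z) lam := by fun_prop
    have h2 : ContinuousAt (fun z => d + (z - lam) ^ p • (1 : 𝔸)) lam := by fun_prop
    exact ((h1.eventuallyEq_nhds_iff_eventuallyEq_nhdsNE h2).1 hinv).eq_of_nhds
  rw [sub_self, zero_smul, sub_zero] at hinv0
  -- Induction on the pole order. For `p > 0` the value at `lam` gives `a F(lam) = d`; dividing `F -
  -- F(lam)` by `z - lam` lowers `p` and replaces `d` by `r F(lam)`, which `a ^ (j + 1)`
  -- annihilates. For `p = 0`, multiply `a F(lam) = d + 1` by `a ^ j`.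
  induction p generalizing F d j with
  | zero =>
    refine ⟨j, F lam, hcomm0, ?_⟩
    rw [pow_succ, mul_assoc, hinv0, mul_add, hd, pow_zero, one_smul, mul_one, zero_add]
  | succ p ih =>
    rw [zero_pow (Nat.succ_ne_zero p), zero_smul, add_zero] at hinv0
    obtain ⟨P, hP⟩ := hF
    have hF1 : AnalyticAt ℂ (dslope F lam) lam := ⟨_, hP.has_fpower_series_dslope_fslope⟩
    have hcomm1 : ∀ᶠ z in 𝓝[≠] lam, Commute a (dslope F lam z) := by
      filter_upwards [hcomm, self_mem_nhdsWithin] with z hz hne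
      rw [dslope_of_ne _ hne, slope_def_module]
      exact (hz.sub_right hcomm0).smul_right _
    have hinv1 : ∀ᶠ z in 𝓝[≠] lam, (a - (z - lam) • r) * dslope F lam z
        = r * F lam + (z - lam) ^ p • (1 : 𝔸) := by
      filter_upwards [hinv, self_mem_nhdsWithin] with z hz hne
      have hs : z - lam ≠ 0 := sub_ne_zero.2 hne
      refine smul_right_injective 𝔸 hs ?_
      change (z - lam) • _ = (z - lam) • _
      rw [← mul_smul_comm, sub_smul_dslope, mul_sub, hz, sub_mul, hinv0, smul_add, smul_smul,
        pow_succ', smul_mul_assoc]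
      abel
    have hd1 : a ^ (j + 1) * (r * F lam) = 0 := by
      rw [← mul_assoc, (har.pow_left (j + 1)).eq, mul_assoc, pow_succ, mul_assoc, hinv0, hd,
        mul_zero]
    have hc1 := hF1.continuousAt
    refine ih hF1 hd1 hcomm1 hinv1 hc1 ?_ ?_
    · have h1 : ContinuousAt (fun z => a * dslope F lam z) lam := by fun_prop
      have h2 : ContinuousAt (fun z => dslope F lam z * a) lam := by fun_prop
      exact ((h1.eventuallyEq_nhds_iff_eventuallyEq_nhdsNE h2).1 hcomm1).eq_of_nhds
    · have h1 : ContinuousAt (fun z => (a - (z - lam) • r) * dslope F lam z) lam := by fun_prop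
      have h2 : ContinuousAt (fun z => r * F lam + (z - lam) ^ p • (1 : 𝔸)) lam := by fun_prop
      have := ((h1.eventuallyEq_nhds_iff_eventuallyEq_nhdsNE h2).1 hinv1).eq_of_nhds
      rwa [sub_self, zero_smul, sub_zero] at this

/-! ### From invertibility on the range of a power to a pole -/

section Bounded

variable {Z : Type*} [NormedAddCommGroup Z] [NormedSpace ℂ Z]

/-- If `a ^ p` factors through a Banach space `W` on which `a` and `r` induce operators `aW`
(invertible) and `rW`, then the inverse of the pencil `a - (z - lam) r`, where `c r = 1 - a`, exists
near `lam` and has at most a pole at `lam`. -/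
theorem meromorphicAt_inverse_of_factor {W : Type*} [NormedAddCommGroup W] [NormedSpace ℂ W]
    [CompleteSpace W] {a r : Z →L[ℂ] Z} {c : ℂ} (hc : c • r = 1 - a) {p : ℕ}
    {aW rW : W →L[ℂ] W} {ι : W →L[ℂ] Z} {π : Z →L[ℂ] W} (hιπ : ι ∘L π = a ^ p)
    (hιa : a ∘L ι = ι ∘L aW) (hιr : r ∘L ι = ι ∘L rW)
    (hπa : π ∘L a = aW ∘L π) (hπr : π ∘L r = rW ∘L π) (hu : IsUnit aW) (lam : ℂ) :
    (∀ᶠ z in 𝓝[≠] lam, IsUnit (a - (z - lam) • r)) ∧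
      MeromorphicAt (fun z => Ring.inverse (a - (z - lam) • r)) lam := by
  let Q : ℂ → (W →L[ℂ] W) := fun z => Ring.inverse (aW - (z - lam) • rW)
  have hlin : AnalyticAt ℂ (fun z => aW - (z - lam) • rW) lam := by fun_prop
  have hQ : AnalyticAt ℂ Q lam := by
    obtain ⟨u, hu'⟩ := hu
    have h0 : aW - (lam - lam) • rW = u := by rw [sub_self, zero_smul, sub_zero, hu']
    exact AnalyticAt.comp_of_eq (analyticAt_inverse (𝕜 := ℂ) u) hlin h0
  have hunit : ∀ᶠ z in 𝓝 lam, IsUnit (aW - (z - lam) • rW) := by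
    refine hlin.continuousAt.eventually_mem (Units.isOpen.mem_nhds ?_)
    simpa using hu
  -- With `s = z - lam`, the relation `c r = 1 - a` gives `s - (c + s) a = -c (a - s r)`. The
  -- geometric sum `V` thus inverts the pencil up to `s ^ p - (c + s) ^ p a ^ p`, while `ι Q π`
  -- inverts it up to `a ^ p`. In `G` the powers of `a` cancel and `s ^ p` remains.
  let V : ℂ → (Z →L[ℂ] Z) := fun z => -c • ∑ i ∈ Finset.range p,
    ((z - lam) • (1 : Z →L[ℂ] Z)) ^ i * ((c + (z - lam)) • a) ^ (p - 1 - i)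
  let G : ℂ → (Z →L[ℂ] Z) := fun z => (c + (z - lam)) ^ p • (ι ∘L (Q z ∘L π)) + V z
  have hG : AnalyticAt ℂ G lam := by
    have hL : AnalyticAt ℂ (fun z => ι ∘L (Q z ∘L π)) lam :=
      (((ContinuousLinearMap.compL ℂ Z W Z ι) ∘L
        ((ContinuousLinearMap.compL ℂ Z W W).flip π)).analyticAt (Q lam)).comp hQ
    have hV : AnalyticAt ℂ V lam := by
      have : AnalyticAt ℂ (fun z => ∑ i ∈ Finset.range p,
          ((z - lam) • (1 : Z →L[ℂ] Z)) ^ i * ((c + (z - lam)) • a) ^ (p - 1 - i)) lam :=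
        Finset.analyticAt_fun_sum _ fun i _ => by fun_prop
      exact (analyticAt_const (v := -c)).smul this
    have hs : AnalyticAt ℂ (fun z => (c + (z - lam)) ^ p) lam := by fun_prop
    exact (hs.smul hL).add hV
  have hpencil : ∀ z, (z - lam) • (1 : Z →L[ℂ] Z) - (c + (z - lam)) • a
      = -c • (a - (z - lam) • r) := fun z => by
    have h1 : c • (z - lam) • r = (z - lam) • (1 - a) := by rw [smul_comm, hc]
    rw [smul_sub, neg_smul c ((z - lam) • r), h1]
    module
  have hcommz : ∀ z, Commute ((z - lam) • (1 : Z →L[ℂ] Z)) ((c + (z - lam)) • a) := fun z =>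
    ((Commute.one_left a).smul_left _).smul_right _
  have hmain : ∀ z, IsUnit (aW - (z - lam) • rW) →
      (a - (z - lam) • r) * G z = (z - lam) ^ p • 1 ∧
      G z * (a - (z - lam) • r) = (z - lam) ^ p • 1 := by
    intro z hz
    have hpow : ((z - lam) • (1 : Z →L[ℂ] Z)) ^ p - ((c + (z - lam)) • a) ^ p
        = (z - lam) ^ p • 1 - (c + (z - lam)) ^ p • a ^ p := by
      rw [smul_pow, smul_pow, one_pow]
    have hl : (a - (z - lam) • r) * V z
        = (z - lam) ^ p • 1 - (c + (z - lam)) ^ p • a ^ p := by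
      rw [← hpow, ← (hcommz z).mul_geom_sum₂, hpencil, mul_smul_comm, smul_mul_assoc]
    have hr : V z * (a - (z - lam) • r)
        = (z - lam) ^ p • 1 - (c + (z - lam)) ^ p • a ^ p := by
      rw [← hpow, ← (hcommz z).geom_sum₂_mul, hpencil, mul_smul_comm, smul_mul_assoc]
    have hιz : (a - (z - lam) • r) ∘L ι = ι ∘L (aW - (z - lam) • rW) := by
      rw [ContinuousLinearMap.sub_comp, ContinuousLinearMap.smul_comp, hιa, hιr,
        ContinuousLinearMap.comp_sub, ContinuousLinearMap.comp_smul]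
    have hπz : π ∘L (a - (z - lam) • r) = (aW - (z - lam) • rW) ∘L π := by
      rw [ContinuousLinearMap.sub_comp, ContinuousLinearMap.smul_comp, ← hπa, ← hπr,
        ContinuousLinearMap.comp_sub, ContinuousLinearMap.comp_smul]
    have hQ1 : (aW - (z - lam) • rW) ∘L Q z = .id ℂ W := Ring.mul_inverse_cancel _ hz
    have hQ2 : Q z ∘L (aW - (z - lam) • rW) = .id ℂ W := Ring.inverse_mul_cancel _ hz
    have hl' : (a - (z - lam) • r) * (ι ∘L (Q z ∘L π)) = a ^ p := by
      rw [ContinuousLinearMap.mul_def, ← ContinuousLinearMap.comp_assoc, hιz,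
        ContinuousLinearMap.comp_assoc, ← ContinuousLinearMap.comp_assoc _ (Q z), hQ1,
        ContinuousLinearMap.id_comp, hιπ]
    have hr' : (ι ∘L (Q z ∘L π)) * (a - (z - lam) • r) = a ^ p := by
      rw [ContinuousLinearMap.mul_def, ContinuousLinearMap.comp_assoc,
        ContinuousLinearMap.comp_assoc, hπz, ← ContinuousLinearMap.comp_assoc (Q z), hQ2,
        ContinuousLinearMap.id_comp, hιπ]
    constructor
    · rw [mul_add, hl, mul_smul_comm, hl']; abel
    · rw [add_mul, hr, smul_mul_assoc, hr']; abel
  have hinv : ∀ᶠ z in 𝓝[≠] lam, IsUnit (a - (z - lam) • r) ∧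
      ((z - lam) ^ p)⁻¹ • G z = Ring.inverse (a - (z - lam) • r) := by
    filter_upwards [hunit.filter_mono nhdsWithin_le_nhds, self_mem_nhdsWithin] with z hz hne
    have hs : (z - lam) ^ p ≠ 0 := pow_ne_zero p (sub_ne_zero.2 hne)
    obtain ⟨h1, h2⟩ := hmain z hz
    let u : (Z →L[ℂ] Z)ˣ := ⟨a - (z - lam) • r, ((z - lam) ^ p)⁻¹ • G z,
      by rw [mul_smul_comm, h1, inv_smul_smul₀ hs], by rw [smul_mul_assoc, h2, inv_smul_smul₀ hs]⟩
    exact ⟨u.isUnit, (Ring.inverse_unit u).symm⟩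
  refine ⟨hinv.mono fun z hz => hz.1, ?_⟩
  refine MeromorphicAt.congr (f := fun z => ((z - lam) ^ p)⁻¹ • G z) ?_ (hinv.mono fun z hz => hz.2)
  have h1 : MeromorphicAt (fun z : ℂ => (z - lam) ^ p) lam :=
    AnalyticAt.meromorphicAt (by fun_prop)
  exact h1.inv.smul hG.meromorphicAt

/-- If `a` is invertible on the closed range of one of its powers, then the inverse of the pencil
`a - (z - lam) r`, where `c r = 1 - a`, exists near `lam` and has at most a pole at `lam`. -/
theorem meromorphicAt_inverse_of_isUnit_restrict [CompleteSpace Z] {a r : Z →L[ℂ] Z}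
    (har : Commute a r) {c : ℂ} (hc : c • r = 1 - a) {p : ℕ}
    (hcl : IsClosed ((a ^ p).range : Set Z))
    (hu : IsUnit (a.restrict (p := (a ^ p).range) (q := (a ^ p).range)
        fun _ hx => map_mem_range_pow a hx)) (lam : ℂ) :
    (∀ᶠ z in 𝓝[≠] lam, IsUnit (a - (z - lam) • r)) ∧
      MeromorphicAt (fun z => Ring.inverse (a - (z - lam) • r)) lam := by
  have : CompleteSpace (a ^ p).range := hcl.completeSpace_coe
  refine meromorphicAt_inverse_of_factor (W := (a ^ p).range) hc (ι := (a ^ p).range.subtypeL)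
    (π := (a ^ p).rangeRestrict) (rW := r.restrict (p := (a ^ p).range) (q := (a ^ p).range)
        fun _ hx => map_mem_range_pow_of_commute har hx) rfl rfl rfl ?_ ?_ hu lam
  · ext x
    exact congrArg (fun u : Z →L[ℂ] Z => u x) ((Commute.refl a).pow_left p).eq
  · ext x
    exact congrArg (fun u : Z →L[ℂ] Z => u x) (har.pow_left p).eq

end Bounded

/-! ### Consequences of Drazin invertibility -/

section Bounded

variable {Z : Type*} [NormedAddCommGroup Z] [NormedSpace ℂ Z]

theorem pow_eq_pow_add_mul_pow {M : Type*} [Monoid M] {a c : M} {q : ℕ}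
    (h : a ^ q = a ^ (q + 1) * c) (k : ℕ) : a ^ q = a ^ (q + k) * c ^ k := by
  induction k with
  | zero => simp
  | succ k ih =>
    calc a ^ q = a ^ (q + k) * c ^ k := ih
      _ = a ^ k * (a ^ (q + 1) * c) * c ^ k := by rw [← h, ← pow_add, add_comm]
      _ = a ^ (q + (k + 1)) * c ^ (k + 1) := by
        rw [← mul_assoc, ← pow_add, mul_assoc, ← pow_succ']
        congr 2
        omega

/-- The range of `a ^ q` is closed if `a` is Drazin invertible of degree `q`. -/
theorem isClosed_range_pow_of_drazin {a c : Z →L[ℂ] Z} (hac : Commute a c) {q : ℕ}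
    (h : a ^ q = a ^ (q + 1) * c) : IsClosed ((a ^ q).range : Set Z) := by
  -- `R(a ^ q)` is the fixed-point set of the bounded operator `a ^ q c ^ q`, hence closed.
  have he : a ^ q * c ^ q * a ^ q = a ^ q := by
    rw [mul_assoc, ((hac.pow_pow q q).eq).symm, ← mul_assoc, ← pow_add,
      ← pow_eq_pow_add_mul_pow h q]
  have hs : ((a ^ q).range : Set Z) = {x | (a ^ q * c ^ q) x = x} := by
    ext x
    constructor
    · rintro ⟨y, rfl⟩
      exact congrArg (fun u : Z →L[ℂ] Z => u y) he
    · intro hx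
      exact ⟨(c ^ q) x, hx⟩
  rw [hs]
  exact isClosed_eq (a ^ q * c ^ q).continuous continuous_id

/-- By commutation `a ^ q = c a a ^ q`, so `c` is a left inverse of `a` on `R(a ^ q)`. -/
theorem eq_zero_of_drazin {a c : Z →L[ℂ] Z} (hac : Commute a c) {q : ℕ}
    (h : a ^ q = a ^ (q + 1) * c) {x : Z} (hx : x ∈ (a ^ q).range) (h0 : a x = 0) : x = 0 := by
  obtain ⟨y, rfl⟩ := hx
  have h' : a ^ q = c * (a * a ^ q) := by
    rw [← pow_succ', ← (hac.pow_left (q + 1)).eq]; exact h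
  calc (a ^ q) y = (c * (a * a ^ q)) y := by rw [← h']
    _ = c (a ((a ^ q) y)) := rfl
    _ = 0 := by erw [h0]; exact map_zero c

theorem range_pow_le_of_drazin {a c : Z →L[ℂ] Z} {q : ℕ}
    (h : a ^ q = a ^ (q + 1) * c) : (a ^ q).range ≤ (a ^ (q + 1)).range := by
  rintro _ ⟨y, rfl⟩
  exact ⟨c y, congrArg (fun u : Z →L[ℂ] Z => u y) h.symm⟩

end Bounded

/-! ### Transfer between `T - lam I` and the bounded pencil -/

section Unbounded

variable {X : Type*} [NormedAddCommGroup X] [NormedSpace ℂ X] {T : X →ₗ.[ℂ] X} {R : X →L[ℂ] X}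
  {mu : ℂ}

/-- The bounded operator `I - (lam - mu) R`; if `R = (T - mu I)⁻¹`, it is equal to
`(T - lam I) R`. -/
noncomputable def pencil (R : X →L[ℂ] X) (mu lam : ℂ) : X →L[ℂ] X := 1 - (lam - mu) • R

theorem commute_pencil (R : X →L[ℂ] X) (mu lam : ℂ) : Commute (pencil R mu lam) R :=
  (Commute.one_left R).sub_left ((Commute.refl R).smul_left _)

theorem pencil_commute_pencil (R : X →L[ℂ] X) (mu lam z : ℂ) :
    Commute (pencil R mu lam) (pencil R mu z) :=
  (Commute.one_right _).sub_right ((commute_pencil R mu lam).smul_right _)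

theorem pencil_eq_sub (R : X →L[ℂ] X) (mu lam z : ℂ) :
    pencil R mu z = pencil R mu lam - (z - lam) • R := by
  unfold pencil; module

theorem shift_comp_inverse (hR : IsBoundedInverse (shift T mu) R) (lam : ℂ) (y : X) :
    ∃ h : R y ∈ (shift T lam).domain, shift T lam ⟨R y, h⟩ = pencil R mu lam y := by
  obtain ⟨h, e⟩ := hR.1 y
  refine ⟨h, ?_⟩
  change T ⟨R y, h⟩ - mu • R y = y at e
  change T ⟨R y, h⟩ - lam • R y = y - (lam - mu) • R y
  rw [sub_eq_iff_eq_add.1 e]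
  module

theorem exists_inverse_eq (hR : IsBoundedInverse (shift T mu) R) {x : X} (hx : x ∈ T.domain) :
    ∃ y, R y = x := ⟨_, hR.2 ⟨x, hx⟩⟩

theorem inverse_injective (hR : IsBoundedInverse (shift T mu) R) {y : X} (hy : R y = 0) :
    y = 0 := by
  obtain ⟨h, e⟩ := hR.1 y
  rw [← e]
  have : (⟨R y, h⟩ : (shift T mu).domain) = 0 := Subtype.ext hy
  rw [this, LinearPMap.map_zero]

theorem isBoundedInverse_of_isUnit_pencil (hR : IsBoundedInverse (shift T mu) R) {lam : ℂ}
    (hu : IsUnit (pencil R mu lam)) :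
    IsBoundedInverse (shift T lam) (R * Ring.inverse (pencil R mu lam)) := by
  constructor
  · intro x
    obtain ⟨h, e⟩ := shift_comp_inverse hR lam (Ring.inverse (pencil R mu lam) x)
    refine ⟨h, e.trans ?_⟩
    exact congrArg (fun u : X →L[ℂ] X => u x) (Ring.mul_inverse_cancel _ hu)
  · rintro ⟨x, hx⟩
    obtain ⟨y, rfl⟩ := exists_inverse_eq hR hx
    obtain ⟨h, e⟩ := shift_comp_inverse hR lam y
    rw [e]
    exact congrArg R (congrArg (fun u : X →L[ℂ] X => u y) (Ring.inverse_mul_cancel _ hu))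

theorem mem_resolventSet_iff_isUnit_pencil [CompleteSpace X]
    (hR : IsBoundedInverse (shift T mu) R) {lam : ℂ} :
    lam ∈ resolventSet T ↔ IsUnit (pencil R mu lam) := by
  refine ⟨?_, fun hu => ⟨_, isBoundedInverse_of_isUnit_pencil hR hu⟩⟩
  rintro ⟨S, hS⟩
  refine ContinuousLinearMap.isUnit_iff_bijective.2 ⟨(injective_iff_map_eq_zero _).2 ?_, ?_⟩
  · intro y hy
    obtain ⟨h, e⟩ := shift_comp_inverse hR lam y
    have := hS.2 ⟨R y, h⟩
    rw [e, hy, map_zero] at this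
    exact inverse_injective hR this.symm
  · intro x
    obtain ⟨h, e⟩ := hS.1 x
    obtain ⟨y, hy⟩ := exists_inverse_eq hR h
    obtain ⟨h', e'⟩ := shift_comp_inverse hR lam y
    refine ⟨y, ?_⟩
    rw [← e', ← e]
    congr 1
    exact Subtype.ext hy

theorem resolvent_eq (hR : IsBoundedInverse (shift T mu) R) {lam : ℂ}
    (hu : IsUnit (pencil R mu lam)) :
    resolvent T lam = R * Ring.inverse (pencil R mu lam) := by
  have hS := isBoundedInverse_of_isUnit_pencil hR hu
  have hex : ∃ S : X →L[ℂ] X, IsBoundedInverse (shift T lam) S := ⟨_, hS⟩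
  have hr : IsBoundedInverse (shift T lam) (resolvent T lam) := by
    rw [resolvent, dif_pos hex]
    exact hex.choose_spec
  ext x
  obtain ⟨h, e⟩ := hS.1 x
  have := hr.2 ⟨_, h⟩
  rwa [e] at this

/-- The inverse of `I - (lam - mu) R` in terms of the resolvent of `T`. -/
theorem inverse_pencil_eq (hR : IsBoundedInverse (shift T mu) R) {lam : ℂ}
    (hu : IsUnit (pencil R mu lam)) :
    Ring.inverse (pencil R mu lam) = 1 + (lam - mu) • resolvent T lam := by
  rw [resolvent_eq hR hu, ← smul_mul_assoc]
  have h1 : (lam - mu) • R = 1 - pencil R mu lam := by rw [pencil, sub_sub_cancel]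
  rw [h1, sub_mul, one_mul, Ring.mul_inverse_cancel _ hu]
  abel

/-- The pencil is the identity modulo `R(R) = D(T)`. This controls the natural domains of the powers
of `T - lam I`. -/
theorem mem_range_inverse_of_pencil {y : X} {lam : ℂ} (h : pencil R mu lam y ∈ R.range) :
    y ∈ R.range := by
  have e : y = pencil R mu lam y + R ((lam - mu) • y) := by
    rw [map_smul]
    change y = y - (lam - mu) • R y + (lam - mu) • R y
    rw [sub_add_cancel]
  rw [e]
  exact R.range.add_mem h ⟨_, rfl⟩

theorem mem_range_inverse_of_pencil_pow {lam : ℂ} (n : ℕ) {y : X}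
    (h : (pencil R mu lam ^ n) y ∈ R.range) : y ∈ R.range := by
  induction n with
  | zero => exact h
  | succ n ih =>
    rw [pow_succ'] at h
    exact ih (mem_range_inverse_of_pencil h)

/-- Since `R` commutes with the pencil, `((T - lam I) R) ^ n` regroups as `(T - lam I) ^ n R ^ n`.
The domain inclusion ensures that the pencil's powers lose no part of the range. -/
theorem pow_shift_comp_inverse_pow (hR : IsBoundedInverse (shift T mu) R) (lam : ℂ) (n : ℕ) :
    (∀ y, ∃ h : (R ^ n) y ∈ (pow (shift T lam) n).domain,
      pow (shift T lam) n ⟨(R ^ n) y, h⟩ = (pencil R mu lam ^ n) y) ∧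
    ∀ x ∈ (pow (shift T lam) n).domain, x ∈ (R ^ n).range := by
  induction n with
  | zero => exact ⟨fun y => ⟨trivial, rfl⟩, fun x _ => ⟨x, rfl⟩⟩
  | succ n ih =>
    obtain ⟨ih1, ih2⟩ := ih
    constructor
    · intro y
      obtain ⟨h, e⟩ := ih1 (R y)
      have hc : (pencil R mu lam ^ n) (R y) = R ((pencil R mu lam ^ n) y) :=
        congrArg (fun u : X →L[ℂ] X => u y) ((commute_pencil R mu lam).pow_left n).eq
      rw [hc] at e
      obtain ⟨h', e'⟩ := shift_comp_inverse hR lam ((pencil R mu lam ^ n) y)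
      have hRy : (R ^ (n + 1)) y = (R ^ n) (R y) := by rw [pow_succ]; rfl
      have hp : (pencil R mu lam ^ (n + 1)) y = pencil R mu lam ((pencil R mu lam ^ n) y) := by
        rw [pow_succ']; rfl
      rw [hRy, hp]
      refine ⟨⟨h, e.symm ▸ h'⟩, Eq.trans ?_ e'⟩
      exact congrArg (shift T lam) (Subtype.ext e)
    · rintro x ⟨hx, hx'⟩
      obtain ⟨y, rfl⟩ := ih2 x hx
      obtain ⟨h, e⟩ := ih1 y
      have h1 : (pencil R mu lam ^ n) y ∈ R.range := by
        rw [← e]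
        exact exists_inverse_eq hR hx'
      obtain ⟨z, rfl⟩ := mem_range_inverse_of_pencil_pow n h1
      exact ⟨z, by rw [pow_succ]; rfl⟩

theorem range_pow_shift (hR : IsBoundedInverse (shift T mu) R) (lam : ℂ) (n : ℕ) :
    range (pow (shift T lam) n) = (pencil R mu lam ^ n).range := by
  obtain ⟨h1, h2⟩ := pow_shift_comp_inverse_pow hR lam n
  ext x
  constructor
  · rintro ⟨⟨x, hx⟩, rfl⟩
    obtain ⟨y, rfl⟩ := h2 x hx
    obtain ⟨h, e⟩ := h1 y
    exact ⟨y, e.symm⟩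
  · rintro ⟨y, rfl⟩
    obtain ⟨h, e⟩ := h1 y
    exact ⟨_, e⟩

/-- A null vector of the pencil satisfies `x = (lam - mu) R x` and so already lies in `D(T)`; the
null spaces agree as subspaces of `X` and can be intersected with the same ranges. -/
theorem shift_eq_zero_iff (hR : IsBoundedInverse (shift T mu) R) (lam : ℂ) (x : X) :
    (∃ h : x ∈ (shift T lam).domain, shift T lam ⟨x, h⟩ = 0) ↔ pencil R mu lam x = 0 := by
  constructor
  · rintro ⟨h, e⟩
    obtain ⟨y, rfl⟩ := exists_inverse_eq hR h
    obtain ⟨h', e'⟩ := shift_comp_inverse hR lam y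
    have hy : pencil R mu lam y = 0 := e'.symm.trans e
    have hc : pencil R mu lam (R y) = R (pencil R mu lam y) :=
      congrArg (fun u : X →L[ℂ] X => u y) (commute_pencil R mu lam).eq
    rw [hc, hy, map_zero]
  · intro hx
    have e : R ((lam - mu) • x) = x := by
      rw [map_smul]
      change x - (lam - mu) • R x = 0 at hx
      exact (sub_eq_zero.1 hx).symm
    obtain ⟨h, e'⟩ := shift_comp_inverse hR lam ((lam - mu) • x)
    rw [map_smul (pencil R mu lam), hx, smul_zero] at e'
    have h' : x ∈ (shift T lam).domain := e ▸ h
    refine ⟨h', Eq.trans ?_ e'⟩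
    exact congrArg (shift T lam) (Subtype.ext e.symm)

/-- Describes the graph by an equation between continuous maps, which makes every part of `T - lam
I` visibly closed. -/
theorem mem_graph_shift_iff (hR : IsBoundedInverse (shift T mu) R) (lam : ℂ) (x y : X) :
    (∃ h : x ∈ (shift T lam).domain, shift T lam ⟨x, h⟩ = y) ↔ R (y + (lam - mu) • x) = x := by
  constructor
  · rintro ⟨h, rfl⟩
    have h1 := hR.2 ⟨x, h⟩
    change R (T ⟨x, h⟩ - mu • x) = x at h1
    change R (T ⟨x, h⟩ - lam • x + (lam - mu) • x) = x
    have h2 : T ⟨x, h⟩ - lam • x + (lam - mu) • x = T ⟨x, h⟩ - mu • x := by module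
    exact (congrArg R h2).trans h1
  · intro h
    obtain ⟨h1, e⟩ := hR.1 (y + (lam - mu) • x)
    have hx : x ∈ T.domain := h ▸ h1
    refine ⟨hx, ?_⟩
    have e' : shift T mu ⟨x, hx⟩ = y + (lam - mu) • x :=
      Eq.trans (congrArg (shift T mu) (Subtype.ext h.symm)) e
    change T ⟨x, hx⟩ - mu • x = _ at e'
    change T ⟨x, hx⟩ - lam • x = y
    rw [sub_eq_iff_eq_add.1 e']
    module

theorem isClosed_part_shift (hR : IsBoundedInverse (shift T mu) R) (lam : ℂ)
    (M : Submodule ℂ X) : (part (shift T lam) M).IsClosed := by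
  have hs : ((part (shift T lam) M).graph : Set (M × M))
      = {w | R ((w.2 : X) + (lam - mu) • (w.1 : X)) = (w.1 : X)} := by
    ext ⟨x, y⟩
    rw [SetLike.mem_coe, LinearPMap.mem_graph_iff, Set.mem_ofPred_eq, ← mem_graph_shift_iff hR]
    constructor
    · rintro ⟨⟨z, hz⟩, rfl, rfl⟩
      exact ⟨hz.1, rfl⟩
    · rintro ⟨h, e⟩
      exact ⟨⟨x, h, e ▸ y.2⟩, rfl, Subtype.ext e⟩
  rw [LinearPMap.IsClosed, hs]
  exact isClosed_eq (by fun_prop) (by fun_prop)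

theorem range_part_range_pow (S : X →ₗ.[ℂ] X) (n : ℕ) :
    range (part S (range (pow S n))) =
      (range (pow S (n + 1))).comap (range (pow S n)).subtype := by
  ext x
  constructor
  · rintro ⟨⟨⟨y, hy⟩, hy'⟩, rfl⟩
    obtain ⟨⟨z, hz⟩, rfl⟩ := hy
    exact ⟨⟨z, hz, hy'.1⟩, rfl⟩
  · rintro ⟨⟨z, hz, hz'⟩, e⟩
    have e' : S ⟨pow S n ⟨z, hz⟩, hz'⟩ = x := e
    exact ⟨⟨⟨pow S n ⟨z, hz⟩, ⟨_, rfl⟩⟩, hz', e' ▸ x.2⟩, Subtype.ext e'⟩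

theorem finiteDimensional_null_part_iff (hR : IsBoundedInverse (shift T mu) R) (lam : ℂ)
    (M : Submodule ℂ X) :
    FiniteDimensional ℂ (null (part (shift T lam) M)) ↔
      FiniteDimensional ℂ ↥((pencil R mu lam).ker ⊓ M) := by
  let f : null (part (shift T lam) M) →ₗ[ℂ] ↥((pencil R mu lam).ker ⊓ M) :=
    { toFun := fun x => ⟨x.1.1.1, (shift_eq_zero_iff hR lam _).1
        ⟨x.1.2.1, congrArg Subtype.val (show part (shift T lam) M x.1 = 0 from x.2)⟩, x.1.1.2⟩
      map_add' := fun _ _ => rfl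
      map_smul' := fun _ _ => rfl }
  have hf : Function.Bijective f := by
    constructor
    · intro x y h
      exact Subtype.ext (Subtype.ext (Subtype.ext (congrArg (fun u : ↥((pencil R mu lam).ker ⊓ M) => (u : X)) h)))
    · rintro ⟨x, hx, hM⟩
      obtain ⟨h, e⟩ := (shift_eq_zero_iff hR lam x).2 hx
      exact ⟨⟨⟨⟨x, hM⟩, h, e ▸ M.zero_mem⟩, Subtype.ext e⟩, rfl⟩
  exact ⟨fun _ => (LinearEquiv.ofBijective f hf).finiteDimensional,
    fun _ => (LinearEquiv.ofBijective f hf).symm.finiteDimensional⟩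

/-- `T - lam I` is B-Fredholm if and only if the bounded operator `I - (lam - mu) R` is. -/
theorem isBFredholm_shift_iff (hR : IsBoundedInverse (shift T mu) R) (lam : ℂ) :
    IsBFredholm (shift T lam) ↔ ∃ n : ℕ, IsClosed ((pencil R mu lam ^ n).range : Set X) ∧
      FiniteDimensional ℂ ↥((pencil R mu lam).ker ⊓ (pencil R mu lam ^ n).range) ∧
      FiniteDimensional ℂ ((pencil R mu lam ^ n).range ⧸
        (pencil R mu lam ^ (n + 1)).range.comap (pencil R mu lam ^ n).range.subtype) := by
  refine exists_congr fun n => ?_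
  rw [IsFredholm, finiteDimensional_null_part_iff hR, range_part_range_pow,
    range_pow_shift hR, range_pow_shift hR, and_iff_right (isClosed_part_shift hR lam _)]

end Unbounded

/-! ### B-Fredholm points and singularities of the resolvent -/

section Unbounded

variable {X : Type*} [NormedAddCommGroup X] [NormedSpace ℂ X] {T : X →ₗ.[ℂ] X} {R : X →L[ℂ] X}
  {mu : ℂ}

theorem isBFredholm_shift_of_drazin (hR : IsBoundedInverse (shift T mu) R) {lam : ℂ}
    {c : X →L[ℂ] X} (hc : Commute (pencil R mu lam) c) {q : ℕ}
    (h : pencil R mu lam ^ q = pencil R mu lam ^ (q + 1) * c) : IsBFredholm (shift T lam) := by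
  refine (isBFredholm_shift_iff hR lam).2 ⟨q, isClosed_range_pow_of_drazin hc h, ?_, ?_⟩
  · have : (pencil R mu lam).ker ⊓ (pencil R mu lam ^ q).range = ⊥ :=
      (Submodule.eq_bot_iff _).2 fun x hx => eq_zero_of_drazin hc h hx.2 hx.1
    rw [this]
    infer_instance
  · have : (pencil R mu lam ^ (q + 1)).range.comap (pencil R mu lam ^ q).range.subtype = ⊤ :=
      (Submodule.eq_top_iff').2 fun x => range_pow_le_of_drazin h x.2
    rw [this]
    infer_instance

theorem continuous_pencil (R : X →L[ℂ] X) (mu : ℂ) : Continuous (pencil R mu) := by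
  unfold pencil; fun_prop

variable [CompleteSpace X]

theorem isOpen_resolventSet (hR : IsBoundedInverse (shift T mu) R) : IsOpen (resolventSet T) := by
  have : resolventSet T = pencil R mu ⁻¹' {u | IsUnit u} :=
    Set.ext fun lam => mem_resolventSet_iff_isUnit_pencil hR
  rw [this]
  exact Units.isOpen.preimage (continuous_pencil R mu)

theorem isBFredholm_shift_of_mem_resolventSet (hR : IsBoundedInverse (shift T mu) R) {lam : ℂ}
    (h : lam ∈ resolventSet T) : IsBFredholm (shift T lam) := by
  obtain ⟨u, hu⟩ := (mem_resolventSet_iff_isUnit_pencil hR).1 h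
  refine isBFredholm_shift_of_drazin hR (c := ((u⁻¹ : (X →L[ℂ] X)ˣ) : X →L[ℂ] X)) (q := 0) ?_ ?_
  · rw [← hu]; exact (Commute.refl (u : X →L[ℂ] X)).units_inv_right
  · rw [← hu, zero_add, pow_one, pow_zero, Units.mul_inv]

theorem isBFredholm_shift_of_isResolventPole (hR : IsBoundedInverse (shift T mu) R) {lam : ℂ}
    (h : IsResolventPole T lam) : IsBFredholm (shift T lam) := by
  obtain ⟨hρ, hm, -⟩ := h
  have hu : ∀ᶠ z in 𝓝[≠] lam, IsUnit (pencil R mu z) :=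
    hρ.mono fun z hz => (mem_resolventSet_iff_isUnit_pencil hR).1 hz
  have hmer : MeromorphicAt (fun z => Ring.inverse (pencil R mu z)) lam := by
    have h1 : MeromorphicAt (fun z : ℂ => z - mu) lam := AnalyticAt.meromorphicAt (by fun_prop)
    refine ((MeromorphicAt.const (1 : X →L[ℂ] X) lam).add (h1.smul hm)).congr ?_
    exact hu.mono fun z hz => (inverse_pencil_eq hR hz).symm
  obtain ⟨p, hp⟩ := hmer
  beta_reduce at hp
  -- Here `F(z) = (z - lam) ^ p (pencil R mu z)⁻¹`, so there is no error term at the start: `d = 0`.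
  obtain ⟨q, c, hc, hq⟩ := exists_pow_eq_pow_succ_mul_of_analyticAt
    (commute_pencil R mu lam) p (d := 0) (j := 0) hp (mul_zero _)
    (hu.mono fun z hz => by
      obtain ⟨u, hu⟩ := hz
      have h1 := pencil_commute_pencil R mu lam z
      rw [← hu] at h1 ⊢
      rw [Ring.inverse_unit]
      exact h1.units_inv_right.smul_right _)
    (hu.mono fun z hz => by
      rw [← pencil_eq_sub, mul_smul_comm, Ring.mul_inverse_cancel _ hz, zero_add])
  exact isBFredholm_shift_of_drazin hR hc hq

/-- At a limit point of the resolvent set where `T - lam I` is B-Fredholm, the resolvent has at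
most an isolated singularity that is at most a pole. -/
theorem meromorphicAt_resolvent_of_isBFredholm (hR : IsBoundedInverse (shift T mu) R) {lam : ℂ}
    (h : IsBFredholm (shift T lam)) (hcl : lam ∈ closure (resolventSet T)) :
    (∀ᶠ z in 𝓝[≠] lam, z ∈ resolventSet T) ∧ MeromorphicAt (resolvent T) lam := by
  obtain ⟨n, h1, h2, h3⟩ := (isBFredholm_shift_iff hR lam).1 h
  obtain ⟨p, hp, hu⟩ := exists_isUnit_restrict_range_pow _ h1 h2 h3 fun ε hε => by
    have hnear : ∀ᶠ z in 𝓝 lam, ‖pencil R mu lam - pencil R mu z‖ < ε := by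
      have hc : Continuous fun z => ‖pencil R mu lam - pencil R mu z‖ :=
        (continuous_const.sub (continuous_pencil R mu)).norm
      refine hc.continuousAt.eventually_lt continuousAt_const ?_
      simpa using hε
    obtain ⟨z, hz, hzε⟩ := ((mem_closure_iff_frequently.1 hcl).and_eventually hnear).exists
    obtain ⟨u, hu⟩ := (mem_resolventSet_iff_isUnit_pencil hR).1 hz
    exact ⟨u, hu ▸ pencil_commute_pencil R mu lam z, hu ▸ hzε⟩
  have hc : (lam - mu) • R = 1 - pencil R mu lam := by rw [pencil, sub_sub_cancel]
  obtain ⟨hev, k, hk⟩ :=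
    meromorphicAt_inverse_of_isUnit_restrict (commute_pencil R mu lam) hc hp hu lam
  simp only [← pencil_eq_sub] at hev hk
  refine ⟨hev.mono fun z hz => (mem_resolventSet_iff_isUnit_pencil hR).2 hz, ?_⟩
  refine MeromorphicAt.congr (f := fun z => R * Ring.inverse (pencil R mu z)) ⟨k, ?_⟩
    (hev.mono fun z hz => (resolvent_eq hR hz).symm)
  have := ((ContinuousLinearMap.mul ℂ (X →L[ℂ] X) R).analyticAt _).comp hk
  refine this.congr (Eventually.of_forall fun z => ?_)
  exact mul_smul_comm _ _ _

/-- An isolated singularity of the resolvent in the spectrum is not removable. -/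
theorem meromorphicOrderAt_resolvent_neg (hR : IsBoundedInverse (shift T mu) R) {lam : ℂ}
    (hlam : lam ∈ spectrum T) (hρ : ∀ᶠ z in 𝓝[≠] lam, z ∈ resolventSet T)
    (hm : MeromorphicAt (resolvent T) lam) : meromorphicOrderAt (resolvent T) lam < 0 := by
  by_contra! hord
  -- A finite limit of the resolvent would give `pencil R mu lam` the inverse `1 + (lam - mu) L`,
  -- putting `lam` in the resolvent set.
  obtain ⟨L, hL⟩ := tendsto_nhds_of_meromorphicOrderAt_nonneg hm hord
  have hu : ∀ᶠ z in 𝓝[≠] lam, IsUnit (pencil R mu z) :=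
    hρ.mono fun z hz => (mem_resolventSet_iff_isUnit_pencil hR).1 hz
  have hsub : Tendsto (fun z : ℂ => z - mu) (𝓝[≠] lam) (𝓝 (lam - mu)) :=
    (continuous_sub_right mu).continuousAt.tendsto.mono_left nhdsWithin_le_nhds
  have hP : Tendsto (pencil R mu) (𝓝[≠] lam) (𝓝 (pencil R mu lam)) :=
    (continuous_pencil R mu).continuousAt.tendsto.mono_left nhdsWithin_le_nhds
  have hI : Tendsto (fun z => Ring.inverse (pencil R mu z)) (𝓝[≠] lam)
      (𝓝 (1 + (lam - mu) • L)) :=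
    (tendsto_const_nhds.add (hsub.smul hL)).congr'
      (hu.mono fun z hz => (inverse_pencil_eq hR hz).symm)
  have e1 : pencil R mu lam * (1 + (lam - mu) • L) = 1 :=
    tendsto_nhds_unique (hP.mul hI) (tendsto_const_nhds.congr'
      (hu.mono fun z hz => (Ring.mul_inverse_cancel _ hz).symm))
  have e2 : (1 + (lam - mu) • L) * pencil R mu lam = 1 :=
    tendsto_nhds_unique (hI.mul hP) (tendsto_const_nhds.congr'
      (hu.mono fun z hz => (Ring.inverse_mul_cancel _ hz).symm))
  exact hlam ((mem_resolventSet_iff_isUnit_pencil hR).2 ⟨⟨_, _, e1, e2⟩, rfl⟩)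

theorem accPt_coe_image_iff (s : Set ℂ) (z : ℂ) :
    AccPt (z : OnePoint ℂ) (𝓟 ((fun w : ℂ => (w : OnePoint ℂ)) '' s)) ↔ AccPt z (𝓟 s) := by
  rw [← OnePoint.isOpenEmbedding_coe.accPt_comap_iff, comap_principal,
    Set.preimage_image_eq _ OnePoint.coe_injective]

/-- If `T - lam I` is B-Fredholm for all `lam ≠ 0`, then no nonzero point is a limit of other
points of the spectrum. -/
theorem eventually_mem_resolventSet_of_bFredholmSpectrum_subset
    (hR : IsBoundedInverse (shift T mu) R) (h : bFredholmSpectrum T ⊆ {0}) {lam : ℂ}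
    (hlam : lam ≠ 0) : ∀ᶠ z in 𝓝[≠] lam, z ∈ resolventSet T := by
  have hopen := isOpen_resolventSet hR
  -- `V` is open, and closed relative to `ℂ ∖ {0}`: a nonzero limit point of `V` is a limit of
  -- resolvent points at which `T - z I` is B-Fredholm, so the local result puts it in `V`.
  let V : Set ℂ := {w | ∀ᶠ z in 𝓝[≠] w, z ∈ resolventSet T}
  have hρV : resolventSet T ⊆ V := fun w hw =>
    (hopen.eventually_mem hw).filter_mono nhdsWithin_le_nhds
  have hVcl : V ⊆ closure (resolventSet T) := fun w hw => mem_closure_iff_frequently.2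
    ((Eventually.frequently (f := 𝓝[≠] w) hw).filter_mono nhdsWithin_le_nhds)
  have hV : IsOpen V := isOpen_iff_eventually.2 fun w hw => by
    filter_upwards [eventually_nhdsWithin_iff.1 hw] with z hz
    by_cases hzw : z = w
    · exact hzw ▸ hw
    · exact hρV (hz hzw)
  have hmu : mu ∈ resolventSet T := ⟨R, hR⟩
  -- `mu` itself may be zero; openness of the resolvent set supplies a nonzero starting point.
  obtain ⟨w, hw, hw0⟩ := (dense_compl_singleton (0 : ℂ)).inter_open_nonempty _ hopen ⟨mu, hmu⟩
  have hconn : IsPreconnected ({0}ᶜ : Set ℂ) := (isConnected_compl_singleton_of_one_lt_rank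
    (Complex.rank_real_complex ▸ Nat.one_lt_ofNat) 0).isPreconnected
  refine hconn.subset_of_closure_inter_subset hV ⟨w, hw0, hρV hw⟩ ?_ hlam
  rintro z ⟨hz, hz0⟩
  have hB : IsBFredholm (shift T z) := by
    by_contra hB
    exact hz0 (h hB)
  exact (meromorphicAt_resolvent_of_isBFredholm hR hB
    (closure_minimal hVcl isClosed_closure hz)).1

end Unbounded

end UnboundedOp

/-! ### The characterisation of the class -/

open UnboundedOp in
theorem mainTheorem9 {X : Type*} [NormedAddCommGroup X] [NormedSpace ℂ X] [CompleteSpace X]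
    (T : X →ₗ.[ℂ] X) (hT : T.IsClosed) (hρ : (UnboundedOp.resolventSet T).Nonempty) :
    UnboundedOp.IsMeromorphicZeroInfty T ↔ UnboundedOp.bFredholmSpectrum T ⊆ {0} := by
  obtain ⟨mu, R, hR⟩ := hρ
  constructor
  · rintro ⟨hacc, hpole⟩ lam hlam
    by_contra h0
    by_cases hmem : lam ∈ resolventSet T
    · exact hlam (isBFredholm_shift_of_mem_resolventSet hR hmem)
    · refine hlam (isBFredholm_shift_of_isResolventPole hR (hpole lam h0 ⟨hmem, fun hA => ?_⟩))
      rcases hacc lam ((accPt_coe_image_iff _ _).2 hA) with h | h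
      · exact h0 (OnePoint.coe_injective h)
      · exact OnePoint.coe_ne_infty lam h
  · intro h
    have hev := fun {lam : ℂ} => eventually_mem_resolventSet_of_bFredholmSpectrum_subset
      (lam := lam) hR h
    constructor
    · intro z hz
      by_contra! hne
      obtain ⟨w, rfl⟩ := OnePoint.ne_infty_iff_exists.1 hne.2
      have hw0 : w ≠ 0 := fun hw => hne.1 (by rw [hw])
      have hA := accPt_iff_frequently_nhdsNE.1 ((accPt_coe_image_iff _ _).1 hz)
      obtain ⟨z, hz, hz'⟩ := (hA.and_eventually (hev hw0)).exists
      exact hz hz'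
    · intro lam h0 hiso
      have hρ := hev h0
      have hB : IsBFredholm (shift T lam) := by
        by_contra hB
        exact h0 (h hB)
      have hm := (meromorphicAt_resolvent_of_isBFredholm hR hB
        (mem_closure_iff_frequently.2 (hρ.frequently.filter_mono nhdsWithin_le_nhds))).2
      exact ⟨hρ, hm, meromorphicOrderAt_resolvent_neg hR hiso.1 hρ hm⟩
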